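/- Let $d,q\ge 0$ be integers, $Z$ a Banach space, $\sigma\ge 0$, $0<\beta\le 1$, and let $F:[0,\infty)\times Z\to Z$ be continuous and locally Lipschitz in the second variable: for all $R,T>0$ there is $L>0$ with $|F(t,z)-F(t,\tilde z)|_Z\le L|z-\tilde z|_Z$ whenever $t\in[0,T]$ and $|z|_Z,|\tilde z|_Z\le R$. Let $C_u(\mathbb{R}^d,Z)$ be the space of bounded uniformly continuous functions $\mathbb{R}^d\to Z$ with the supremum norm. Let $g_\beta$ be the function on $\mathbb{R}^d$ with Fourier transform $\int_{\mathbb{R}^d} g_\beta(x)e^{-ix\cdot\xi}\,dx=e^{-|\xi|^{2\beta}}$, and for $\sigma t>0$ put $G_{\sigma,\beta}(t,x)=(\sigma t)^{-d/(2\beta)}g_\beta\big((\sigma t)^{-1/(2\beta)}x\big)$ and $S(t)f=G_{\sigma,\beta}(t,\cdot)*f$; put $S(t)f=f$ if $\sigma t=0$. Given $u_0\in C_u(\mathbb{R}^d,Z)$ and an interval $I=[0,T]$ or $I=[0,T)$, a mild solution of $\partial_t u+\sigma(-\Delta)^\beta u=F(t,u)$, $u(0)=u_0$, on $I$ is a function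 $u\in C(I,C_u(\mathbb{R}^d,Z))$ such that for all $t\in I$ $$u(t)=S(t)u_0+\int_0^t S(t-s)F(s,u(s))\,ds,\qquad F(s,u(s))(x)=F(s,u(s)(x)),$$ the equation being understood at each point $x\in\mathbb{R}^d$, with an integrable integrand. Let $T^*(u_0)\in[0,\infty]$ be the supremum of all $T\ge 0$ such that a mild solution with initial datum $u_0$ exists on $[0,T]$. Let $\gamma_1,\dots,\gamma_q\in\mathbb{R}^d$ be linearly independent and $\Gamma=\{n_1\gamma_1+\dots+n_q\gamma_q:\ n_j\in\mathbb{Z}\}$; a function $v\in C_u(\mathbb{R}^d,Z)$ is called $\Gamma$-periodic if $v(x+\gamma)=v(x)$ for all $x\in\mathbb{R}^d$ and $\gamma\in\Gamma$. If $u_0\in C_u(\mathbb{R}^d,Z)$ is $\Gamma$-periodic and $u$ is the mild solution on $[0,T^*(u_0))$ with initial datum $u_0$, then $u(t)$ is $\Gamma$-periodic for every $0\le t<T^*(u_0)$. -/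

import Mathlib

open Set MeasureTheory
open scoped BoundedContinuousFunction FourierTransform

noncomputable section

/-- `C_u(ℝᵈ, Z)`: bounded uniformly continuous functions `ℝᵈ → Z`, with the supremum norm
(inherited from the bounded continuous functions). -/
def Cu (d : ℕ) (Z : Type*) [NormedAddCommGroup Z] [NormedSpace ℝ Z] :
    Submodule ℝ (EuclideanSpace ℝ (Fin d) →ᵇ Z) where
  carrier := {u | UniformContinuous u}
  zero_mem' := uniformContinuous_const
  add_mem' := fun hu hv => UniformContinuous.add hu hv
  smul_mem' := fun c _ hu => UniformContinuous.const_smul hu c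

/-- The function `g_β` on `ℝᵈ` whose Fourier transform `∫ g(x) e^{-i x·ξ} dx` is `e^{-|ξ|^{2β}}`.
Mathlib's Fourier transform is normalised with `e^{-2π i x·ξ}`, hence the factor `2π`. -/
def stableDensity (d : ℕ) (β : ℝ) (x : EuclideanSpace ℝ (Fin d)) : ℝ :=
  (𝓕⁻ (fun ξ : EuclideanSpace ℝ (Fin d) =>
    ((Real.exp (-((2 * Real.pi * ‖ξ‖) ^ (2 * β))) : ℝ) : ℂ)) x).re

/-- The Green function `G_{σ,β}(t, x) = (σt)^{-d/(2β)} g_β((σt)^{-1/(2β)} x)` of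
`∂ₜ + σ(-Δ)^β`, for `σ t > 0`. -/
def greenFunction (d : ℕ) (σ β t : ℝ) (x : EuclideanSpace ℝ (Fin d)) : ℝ :=
  (σ * t) ^ (-((d : ℝ) / (2 * β))) * stableDensity d β ((σ * t) ^ (-(1 / (2 * β))) • x)

/-- The semigroup generated by `-σ(-Δ)^β`: `S(t) f = G_{σ,β}(t, ·) * f` for `σ t > 0`, and the
identity for `t = 0` or `σ = 0`. -/
def fracSemigroup {d : ℕ} {Z : Type*} [NormedAddCommGroup Z] [NormedSpace ℝ Z]
    (σ β t : ℝ) (f : EuclideanSpace ℝ (Fin d) → Z) (x : EuclideanSpace ℝ (Fin d)) : Z :=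
  open Classical in
  if σ * t = 0 then f x else ∫ y, greenFunction d σ β t y • f (x - y)

/-- `F : ℝ₊ × Z → Z` is locally Lipschitz in the second variable. -/
def LocallyLipschitzInSnd {Z : Type*} [NormedAddCommGroup Z] (F : ℝ → Z → Z) : Prop :=
  ∀ R > 0, ∀ T > 0, ∃ L > 0, ∀ t ∈ Icc (0 : ℝ) T, ∀ z z' : Z, ‖z‖ ≤ R → ‖z'‖ ≤ R →
    ‖F t z - F t z'‖ ≤ L * ‖z - z'‖

/-- `u` is a mild solution of `∂ₜ u + σ(-Δ)^β u = F(t, u)` with initial datum `u₀` on the time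
interval `I` (of the form `[0, T]` or `[0, T)`): `u ∈ C(I, C_u(ℝᵈ, Z))` and
`u(t) = S(t) u₀ + ∫₀ᵗ S(t - s) F(s, u(s)) ds` for `t ∈ I`, where `F(s, u(s))(x) = F(s, u(s)(x))`.
The equation between functions on `ℝᵈ` is written out at each point `x`. -/
structure IsMildSolutionOn {d : ℕ} {Z : Type*} [NormedAddCommGroup Z] [NormedSpace ℝ Z]
    (σ β : ℝ) (F : ℝ → Z → Z) (u₀ : Cu d Z) (I : Set ℝ) (u : ℝ → Cu d Z) : Prop where
  continuousOn : ContinuousOn u I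
  integrable : ∀ t ∈ I, ∀ x : EuclideanSpace ℝ (Fin d),
    IntervalIntegrable
      (fun s => fracSemigroup σ β (t - s) (fun y => F s ((u s).1 y)) x) volume 0 t
  equation : ∀ t ∈ I, ∀ x : EuclideanSpace ℝ (Fin d),
    (u t).1 x = fracSemigroup σ β t (fun y => u₀.1 y) x
      + ∫ s in (0 : ℝ)..t, fracSemigroup σ β (t - s) (fun y => F s ((u s).1 y)) x

/-- The maximal time of existence `T*(u₀) ∈ [0, ∞]`: the supremum of the `T ≥ 0` for which there
is a mild solution on `[0, T]` with initial datum `u₀`. -/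
def maximalTime {d : ℕ} {Z : Type*} [NormedAddCommGroup Z] [NormedSpace ℝ Z]
    (σ β : ℝ) (F : ℝ → Z → Z) (u₀ : Cu d Z) : EReal :=
  sSup {τ : EReal | ∃ T : ℝ, 0 ≤ T ∧ τ = (T : EReal) ∧
    ∃ u : ℝ → Cu d Z, IsMildSolutionOn σ β F u₀ (Icc 0 T) u}

/-- The lattice `{n₁γ₁ + ⋯ + n_qγ_q : n_j ∈ ℤ}`. -/
def latticeOf {d q : ℕ} (γ : Fin q → EuclideanSpace ℝ (Fin d)) :
    Set (EuclideanSpace ℝ (Fin d)) :=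
  {v | ∃ n : Fin q → ℤ, v = ∑ j, n j • γ j}

/-- `C_u(ℝᵈ/Γ, Z)`: the `Γ`-periodic elements of `C_u(ℝᵈ, Z)`. -/
def CuPeriodic {d : ℕ} (Z : Type*) [NormedAddCommGroup Z] [NormedSpace ℝ Z]
    (Γ : Set (EuclideanSpace ℝ (Fin d))) : Set (Cu d Z) :=
  {u | ∀ v ∈ Γ, ∀ x, u.1 (x + v) = u.1 x}

end

/-! Translating a mild solution by a period of `u₀` gives a mild solution with the same datum, so
the claim is uniqueness of mild solutions, which follows from Grönwall's inequality once `S(t)` is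
a contraction for the supremum norm, that is once `g_β` has `L¹` norm at most `1`.

The one-sided `β`-stable law is a limit of rescaled sums of Sibuya variables, so `exp (-x ^ β)` is
a limit of powers of Laplace transforms of Sibuya laws. With `x = |ξ|²` these are positive mixtures
of Gaussians, hence the Fourier transform `g_β` of `exp (-|ξ| ^ (2β))` is nonnegative. A nonnegative
Fourier transform of an integrable function has `L¹` norm at most the supremum of that function. -/

open Filter Topology
open scoped ComplexOrder ENNReal

/-- The weights of the Sibuya distribution with parameter `β`: the coefficients in
`1 - (1 - z) ^ β = ∑ₖ sibuyaWeight β k * z ^ (k + 1)`, so that `k` carries the mass of `k + 1`. -/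
noncomputable def sibuyaWeight (β : ℝ) (k : ℕ) : ℝ := (-1) ^ k * Ring.choose β (k + 1)

theorem succ_mul_sibuyaWeight_succ (β : ℝ) (k : ℕ) :
    ((k : ℝ) + 2) * sibuyaWeight β (k + 1) = (k + 1 - β) * sibuyaWeight β k := by
  have h := Ring.choose_smul_choose β (Nat.le_succ (k + 1))
  simp only [Nat.succ_eq_add_one, Nat.choose_succ_self_right, add_tsub_cancel_left,
    Ring.choose_one_right, nsmul_eq_mul, Nat.cast_add, Nat.cast_one] at h
  simp only [sibuyaWeight, pow_succ]
  linear_combination -(-1 : ℝ) ^ k * h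

theorem sibuyaWeight_nonneg {β : ℝ} (hβ₀ : 0 ≤ β) (hβ₁ : β ≤ 1) (k : ℕ) :
    0 ≤ sibuyaWeight β k := by
  induction k with
  | zero => simpa [sibuyaWeight] using hβ₀
  | succ k ih =>
    refine nonneg_of_mul_nonneg_right (a := (k : ℝ) + 2) ?_ (by positivity)
    rw [succ_mul_sibuyaWeight_succ]
    exact mul_nonneg (by linarith) ih

theorem hasSum_sibuyaWeight_mul_pow (β : ℝ) {z : ℝ} (hz : |z| < 1) :
    HasSum (fun k => sibuyaWeight β k * z ^ (k + 1)) (1 - (1 - z) ^ β) := by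
  have h := (Real.one_add_rpow_hasFPowerSeriesOnBall_zero (a := β)).hasSum (y := -z) (by
    simpa [Metric.mem_eball, ← ofReal_norm] using hz)
  simp only [zero_add, binomialSeries_apply, List.ofFn_const, List.prod_replicate,
    smul_eq_mul] at h
  rw [← hasSum_nat_add_iff' 1] at h
  simp only [Finset.range_one, Finset.sum_singleton, Ring.choose_zero_right, pow_zero,
    mul_one] at h
  have hneg := h.neg
  rw [neg_sub, ← sub_eq_add_neg] at hneg
  refine hneg.congr_fun fun k => ?_
  rw [sibuyaWeight, neg_pow z, pow_succ (-1 : ℝ)]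
  ring

/-- The Laplace transform of the Sibuya distribution with parameter `β`. -/
noncomputable def sibuyaLaplace (β l : ℝ) : ℝ := 1 - (1 - Real.exp (-l)) ^ β

theorem hasSum_sibuyaLaplace (β : ℝ) {l : ℝ} (hl : 0 < l) :
    HasSum (fun k : ℕ => sibuyaWeight β k * Real.exp (-((k + 1) * l))) (sibuyaLaplace β l) := by
  have hz : |Real.exp (-l)| < 1 := by
    rw [Real.abs_exp, Real.exp_lt_one_iff]
    exact neg_lt_zero.2 hl
  refine (hasSum_sibuyaWeight_mul_pow β hz).congr_fun fun k => ?_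
  rw [← Real.exp_nat_mul]
  push_cast
  ring_nf

theorem sibuyaLaplace_mem_Icc {β l : ℝ} (hβ : 0 ≤ β) (hl : 0 ≤ l) :
    sibuyaLaplace β l ∈ Icc 0 1 := by
  have hexp : Real.exp (-l) ≤ 1 := Real.exp_le_one_iff.2 (neg_nonpos.2 hl)
  have hnonneg : 0 ≤ 1 - Real.exp (-l) := sub_nonneg.2 hexp
  exact ⟨sub_nonneg.2 (Real.rpow_le_one hnonneg (sub_le_self _ (Real.exp_nonneg _)) hβ),
    sub_le_self _ (Real.rpow_nonneg hnonneg _)⟩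

theorem tendsto_one_sub_exp_neg_div_self :
    Tendsto (fun y : ℝ => (1 - Real.exp (-y)) / y) (𝓝[>] 0) (𝓝 1) := by
  have h := (((hasDerivAt_id (0 : ℝ)).neg.exp).const_sub 1).tendsto_slope.mono_left
    (nhdsGT_le_nhdsNE 0)
  simp only [slope_fun_def_field] at h
  simpa using h

theorem tendsto_mul_natCast_rpow_neg {x p : ℝ} (hx : 0 < x) (hp : 0 < p) :
    Tendsto (fun n : ℕ => x * (n : ℝ) ^ (-p)) atTop (𝓝[>] 0) := by
  refine tendsto_nhdsWithin_iff.2 ⟨?_, ?_⟩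
  · simpa using ((tendsto_rpow_neg_atTop hp).comp tendsto_natCast_atTop_atTop).const_mul x
  · filter_upwards [eventually_gt_atTop 0] with n hn
    exact mul_pos hx (Real.rpow_pos_of_pos (Nat.cast_pos.2 hn) _)

/-- Sums of `n` independent Sibuya variables, rescaled by `n ^ (-1 / β)`, converge to the one-sided
`β`-stable distribution, whose Laplace transform is `exp (-x ^ β)`. -/
theorem tendsto_sibuyaLaplace_pow {β x : ℝ} (hβ : 0 < β) (hx : 0 < x) :
    Tendsto (fun n : ℕ => sibuyaLaplace β (x * (n : ℝ) ^ (-(1 / β))) ^ n) atTop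
      (𝓝 (Real.exp (-x ^ β))) := by
  set y : ℕ → ℝ := fun n => x * (n : ℝ) ^ (-(1 / β)) with hy
  have hy₀ : Tendsto y atTop (𝓝[>] 0) := tendsto_mul_natCast_rpow_neg hx (by positivity)
  have hratio : Tendsto (fun n => x ^ β * ((1 - Real.exp (-y n)) / y n) ^ β) atTop
      (𝓝 (x ^ β)) := by
    simpa using ((tendsto_one_sub_exp_neg_div_self.comp hy₀).rpow_const (p := β)
      (Or.inl one_ne_zero)).const_mul (x ^ β)
  have hcount : Tendsto (fun n : ℕ => (n : ℝ) * -(1 - Real.exp (-y n)) ^ β) atTop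
      (𝓝 (-x ^ β)) := by
    refine hratio.neg.congr' ?_
    filter_upwards [eventually_gt_atTop 0] with n hn
    have hn₀ : (0 : ℝ) < n := Nat.cast_pos.2 hn
    have hyn : 0 < y n := mul_pos hx (Real.rpow_pos_of_pos hn₀ _)
    have hexp : 0 ≤ 1 - Real.exp (-y n) :=
      sub_nonneg.2 (Real.exp_le_one_iff.2 (neg_nonpos.2 hyn.le))
    have hypow : y n ^ β = x ^ β * (n : ℝ)⁻¹ := by
      rw [hy, Real.mul_rpow hx.le (Real.rpow_nonneg hn₀.le _), ← Real.rpow_mul hn₀.le,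
        show -(1 / β) * β = -1 by field_simp, Real.rpow_neg_one]
    have hxβ : x ^ β ≠ 0 := (Real.rpow_pos_of_pos hx _).ne'
    rw [Real.div_rpow hexp hyn.le, hypow]
    field_simp
  refine (Real.tendsto_one_add_pow_exp_of_tendsto hcount).congr fun n => ?_
  rw [sibuyaLaplace, ← sub_eq_add_neg]

section Gaussian

variable {V : Type*} [NormedAddCommGroup V]

/-- The centred Gaussian `exp (-b ‖v‖²)`, by which Fourier integrals are regularised. It is
complex-valued because it is multiplied with the arguments of Mathlib's Fourier transform. -/
noncomputable def gaussianWeight (b : ℝ) (v : V) : ℂ := Complex.exp (-b * ‖v‖ ^ 2)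

theorem gaussianWeight_eq_ofReal (b : ℝ) (v : V) :
    gaussianWeight b v = (Real.exp (-(b * ‖v‖ ^ 2)) : ℝ) := by
  simp [gaussianWeight]

theorem gaussianWeight_zero (v : V) : gaussianWeight 0 v = 1 := by
  simp [gaussianWeight]

theorem gaussianWeight_nonneg (b : ℝ) (v : V) : 0 ≤ gaussianWeight b v := by
  rw [gaussianWeight_eq_ofReal]
  exact Complex.zero_le_real.2 (Real.exp_nonneg _)

theorem norm_gaussianWeight_le_one {b : ℝ} (hb : 0 ≤ b) (v : V) : ‖gaussianWeight b v‖ ≤ 1 := by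
  rw [gaussianWeight_eq_ofReal, Complex.norm_of_nonneg (Real.exp_nonneg _)]
  exact Real.exp_le_one_iff.2 (neg_nonpos.2 (by positivity))

theorem gaussianWeight_add (b s : ℝ) (v : V) :
    gaussianWeight (b + s) v = gaussianWeight b v * gaussianWeight s v := by
  rw [gaussianWeight, gaussianWeight, gaussianWeight, ← Complex.exp_add]
  push_cast
  ring_nf

theorem continuous_gaussianWeight (b : ℝ) : Continuous (gaussianWeight b : V → ℂ) := by
  unfold gaussianWeight
  fun_prop

theorem tendsto_gaussianWeight_zero (v : V) :
    Tendsto (fun b => gaussianWeight b v) (𝓝[>] 0) (𝓝 1) := by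
  have hcont : Continuous fun b : ℝ => gaussianWeight b v := by
    unfold gaussianWeight
    fun_prop
  simpa only [gaussianWeight_zero] using (hcont.tendsto 0).mono_left nhdsWithin_le_nhds

variable [InnerProductSpace ℝ V] [FiniteDimensional ℝ V] [MeasurableSpace V] [BorelSpace V]

theorem integrable_gaussianWeight {b : ℝ} (hb : 0 < b) :
    Integrable (gaussianWeight b : V → ℂ) := by
  refine (GaussianFourier.integrable_cexp_neg_mul_sq_norm_add (V := V) (b := b) hb 0 0).congr
    (ae_of_all _ fun v => ?_)
  simp only [gaussianWeight, zero_mul, add_zero]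

theorem fourier_gaussianWeight {b : ℝ} (hb : 0 < b) (w : V) :
    𝓕 (gaussianWeight b : V → ℂ) w =
      ((Real.pi / b) ^ (Module.finrank ℝ V / 2 : ℝ) : ℝ) * gaussianWeight (Real.pi ^ 2 / b) w := by
  refine (fourier_gaussian_innerProductSpace (by simpa using hb) w).trans ?_
  rw [Complex.ofReal_cpow (by positivity), gaussianWeight]
  push_cast
  ring_nf

theorem fourier_gaussianWeight_nonneg {b : ℝ} (hb : 0 < b) (w : V) :
    0 ≤ 𝓕 (gaussianWeight b : V → ℂ) w := by
  rw [fourier_gaussianWeight hb]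
  exact mul_nonneg (Complex.zero_le_real.2 (by positivity)) (gaussianWeight_nonneg _ _)

theorem integrable_fourier_gaussianWeight {b : ℝ} (hb : 0 < b) :
    Integrable (𝓕 (gaussianWeight b : V → ℂ)) := by
  rw [funext (fourier_gaussianWeight hb)]
  exact (integrable_gaussianWeight (by positivity)).const_mul _

theorem integral_norm_fourier_gaussianWeight {b : ℝ} (hb : 0 < b) :
    ∫ w : V, ‖𝓕 (gaussianWeight b : V → ℂ) w‖ = 1 := by
  have hnorm : ∀ w : V, ‖𝓕 (gaussianWeight b : V → ℂ) w‖ =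
      (Real.pi / b) ^ (Module.finrank ℝ V / 2 : ℝ) * Real.exp (-(Real.pi ^ 2 / b) * ‖w‖ ^ 2) := by
    intro w
    rw [fourier_gaussianWeight hb, gaussianWeight_eq_ofReal, ← Complex.ofReal_mul,
      Complex.norm_of_nonneg (by positivity), neg_mul]
  simp only [hnorm]
  rw [integral_const_mul, GaussianFourier.integral_rexp_neg_mul_sq_norm (by positivity),
    ← Real.mul_rpow (by positivity) (by positivity),
    show Real.pi / b * (Real.pi / (Real.pi ^ 2 / b)) = 1 by field_simp, Real.one_rpow]

end Gaussian

section FourierNonneg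

variable {V : Type*} [NormedAddCommGroup V] [InnerProductSpace ℝ V] [FiniteDimensional ℝ V]
  [MeasurableSpace V] [BorelSpace V]

theorem tendsto_fourier_of_dominated {ι : Type*} {l : Filter ι} [l.IsCountablyGenerated]
    {φ : ι → V → ℂ} {φ₀ : V → ℂ} {bound : V → ℝ} (hmeas : ∀ᶠ i in l, AEStronglyMeasurable (φ i))
    (hle : ∀ᶠ i in l, ∀ᵐ v, ‖φ i v‖ ≤ bound v) (hbound : Integrable bound)
    (hlim : ∀ᵐ v, Tendsto (fun i => φ i v) l (𝓝 (φ₀ v))) (w : V) :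
    Tendsto (fun i => 𝓕 (φ i) w) l (𝓝 (𝓕 φ₀ w)) := by
  simp only [Real.fourier_eq]
  refine tendsto_integral_filter_of_dominated_convergence bound ?_ ?_ hbound ?_
  · filter_upwards [hmeas] with i hi
    exact AEStronglyMeasurable.fun_smul (Continuous.aestronglyMeasurable (by fun_prop)) hi
  · simpa only [Circle.norm_smul] using hle
  · filter_upwards [hlim] with v hv
    exact hv.const_smul _

/-- A bounded function whose Fourier transform is nonnegative, in the sense that all its Gaussian
regularisations have nonnegative Fourier transforms. Unlike nonnegativity of `𝓕 φ` itself, this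
makes sense without integrability of `φ`, e.g. for constants. -/
structure IsFourierNonneg (φ : V → ℂ) : Prop where
  memLp_top : MemLp φ ∞
  fourier_gaussianWeight_mul_nonneg :
    ∀ b, 0 < b → ∀ w, 0 ≤ 𝓕 (fun v => gaussianWeight b v * φ v) w

namespace IsFourierNonneg

variable {φ ψ : V → ℂ}

theorem integrable_gaussianWeight_mul (h : IsFourierNonneg φ) {b : ℝ} (hb : 0 < b) :
    Integrable fun v => gaussianWeight b v * φ v :=
  (integrable_gaussianWeight hb).mul_of_top_left h.memLp_top

theorem one : IsFourierNonneg fun _ : V => 1 where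
  memLp_top := memLp_top_const 1
  fourier_gaussianWeight_mul_nonneg b hb w := by
    simpa only [mul_one] using fourier_gaussianWeight_nonneg hb w

theorem zero : IsFourierNonneg fun _ : V => 0 where
  memLp_top := memLp_top_const 0
  fourier_gaussianWeight_mul_nonneg b _ w := by simp [Real.fourier_eq]

theorem add (hφ : IsFourierNonneg φ) (hψ : IsFourierNonneg ψ) :
    IsFourierNonneg fun v => φ v + ψ v where
  memLp_top := hφ.memLp_top.add hψ.memLp_top
  fourier_gaussianWeight_mul_nonneg b hb w := by
    have hadd := congrFun (VectorFourier.fourierIntegral_add (L := innerₗ V)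
      Real.continuous_fourierChar continuous_inner (hφ.integrable_gaussianWeight_mul hb)
      (hψ.integrable_gaussianWeight_mul hb)) w
    simp only [mul_add]
    exact (add_nonneg (hφ.fourier_gaussianWeight_mul_nonneg b hb w)
      (hψ.fourier_gaussianWeight_mul_nonneg b hb w)).trans_eq hadd.symm

theorem const_mul (hφ : IsFourierNonneg φ) {a : ℂ} (ha : 0 ≤ a) :
    IsFourierNonneg fun v => a * φ v where
  memLp_top := hφ.memLp_top.const_mul a
  fourier_gaussianWeight_mul_nonneg b hb w := by
    have hsmul := congrFun (VectorFourier.fourierIntegral_const_smul Real.fourierChar volume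
      (innerₗ V) (fun v => gaussianWeight b v * φ v) a) w
    simp only [mul_left_comm _ a]
    exact (mul_nonneg ha (hφ.fourier_gaussianWeight_mul_nonneg b hb w)).trans_eq hsmul.symm

theorem gaussianWeight_mul (hφ : IsFourierNonneg φ) {s : ℝ} (hs : 0 ≤ s) :
    IsFourierNonneg fun v => gaussianWeight s v * φ v where
  memLp_top := hφ.memLp_top.mul (memLp_top_of_bound
    (continuous_gaussianWeight s).aestronglyMeasurable 1
    (ae_of_all _ (norm_gaussianWeight_le_one hs)))
  fourier_gaussianWeight_mul_nonneg b hb w := by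
    simpa only [gaussianWeight_add, mul_assoc] using
      hφ.fourier_gaussianWeight_mul_nonneg (b + s) (by positivity) w

theorem sum {ι : Type*} {f : ι → V → ℂ} (hf : ∀ i, IsFourierNonneg (f i)) (s : Finset ι) :
    IsFourierNonneg fun v => ∑ i ∈ s, f i v := by
  classical
  induction s using Finset.induction_on with
  | empty => simpa only [Finset.sum_empty] using zero
  | insert i s hi ih => simpa only [Finset.sum_insert hi] using (hf i).add ih

theorem of_tendsto {f : ℕ → V → ℂ} {C : ℝ} (hf : ∀ n, IsFourierNonneg (f n))
    (hbound : ∀ n, ∀ᵐ v, ‖f n v‖ ≤ C)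
    (hlim : ∀ᵐ v, Tendsto (fun n => f n v) atTop (𝓝 (φ v))) : IsFourierNonneg φ where
  memLp_top := by
    refine memLp_top_of_bound (aestronglyMeasurable_of_tendsto_ae atTop
      (fun n => (hf n).memLp_top.aestronglyMeasurable) hlim) C ?_
    filter_upwards [ae_all_iff.2 hbound, hlim] with v hv hφ
    exact le_of_tendsto' hφ.norm hv
  fourier_gaussianWeight_mul_nonneg b hb w := by
    refine ge_of_tendsto' (tendsto_fourier_of_dominated (l := atTop)
      (φ := fun n v => gaussianWeight b v * f n v)
      (bound := fun v => ‖gaussianWeight b v‖ * C) (.of_forall fun n =>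
        ((hf n).integrable_gaussianWeight_mul hb).aestronglyMeasurable) (.of_forall fun n => ?_)
      ((integrable_gaussianWeight hb).norm.mul_const C) ?_ w)
      fun n => (hf n).fourier_gaussianWeight_mul_nonneg b hb w
    · filter_upwards [hbound n] with v hv
      rw [norm_mul]
      gcongr
    · filter_upwards [hlim] with v hv
      exact hv.const_mul _

theorem hasSum_gaussianWeight_mul {a r : ℕ → ℝ} {m : V → ℝ} (hφ : IsFourierNonneg φ) {C D : ℝ}
    (ha : ∀ k, 0 ≤ a k) (hr : ∀ k, 0 ≤ r k) (hφC : ∀ᵐ v, ‖φ v‖ ≤ C)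
    (hmD : ∀ᵐ v, m v ≤ D)
    (hm : ∀ᵐ v, HasSum (fun k => a k * Real.exp (-(r k * ‖v‖ ^ 2))) (m v)) :
    IsFourierNonneg fun v => m v * φ v := by
  have hterm : ∀ k, IsFourierNonneg fun v => (a k : ℂ) * (gaussianWeight (r k) v * φ v) :=
    fun k => (hφ.gaussianWeight_mul (hr k)).const_mul (Complex.zero_le_real.2 (ha k))
  have hpartial : ∀ (n : ℕ) (v : V),
      ∑ k ∈ Finset.range n, (a k : ℂ) * (gaussianWeight (r k) v * φ v) =
        (∑ k ∈ Finset.range n, a k * Real.exp (-(r k * ‖v‖ ^ 2)) : ℝ) * φ v := fun n v => by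
    simp only [Complex.ofReal_sum, Finset.sum_mul, Complex.ofReal_mul, gaussianWeight_eq_ofReal,
      mul_assoc]
  refine of_tendsto (C := D * C) (fun n => sum hterm (Finset.range n)) (fun n => ?_) ?_
  · filter_upwards [hφC, hmD, hm] with v hφv hmv hsum
    have hnonneg : ∀ k, 0 ≤ a k * Real.exp (-(r k * ‖v‖ ^ 2)) := fun k =>
      mul_nonneg (ha k) (Real.exp_nonneg _)
    rw [hpartial, norm_mul, Complex.norm_of_nonneg (Finset.sum_nonneg fun k _ => hnonneg k)]
    exact mul_le_mul ((sum_le_hasSum _ (fun k _ => hnonneg k) hsum).trans hmv) hφv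
      (norm_nonneg _) ((hsum.nonneg hnonneg).trans hmv)
  · filter_upwards [hm] with v hsum
    simp only [hpartial]
    exact ((Complex.continuous_ofReal.tendsto _).comp hsum.tendsto_sum_nat).mul_const _

theorem sibuyaLaplace_pow [Nontrivial V] {β c : ℝ} (hβ₀ : 0 ≤ β) (hβ₁ : β ≤ 1) (hc : 0 < c)
    (n : ℕ) : IsFourierNonneg fun v : V => ((sibuyaLaplace β (c * ‖v‖ ^ 2) ^ n : ℝ) : ℂ) := by
  have hmem : ∀ v : V, sibuyaLaplace β (c * ‖v‖ ^ 2) ∈ Icc 0 1 := fun v =>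
    sibuyaLaplace_mem_Icc hβ₀ (by positivity)
  induction n with
  | zero => simpa only [pow_zero, Complex.ofReal_one] using one
  | succ n ih =>
    simp only [pow_succ' (sibuyaLaplace _ _), Complex.ofReal_mul]
    refine ih.hasSum_gaussianWeight_mul (C := 1) (D := 1) (a := sibuyaWeight β)
      (r := fun k => (k + 1) * c) (sibuyaWeight_nonneg hβ₀ hβ₁) (fun k => by positivity)
      (ae_of_all _ fun v => ?_) (ae_of_all _ fun v => (hmem v).2) ?_
    · rw [Complex.norm_of_nonneg (pow_nonneg (hmem v).1 n)]
      exact pow_le_one₀ (hmem v).1 (hmem v).2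
    · filter_upwards [Measure.ae_ne volume (0 : V)] with v hv
      simpa only [mul_assoc] using hasSum_sibuyaLaplace β (l := c * ‖v‖ ^ 2) (by positivity)

theorem exp_neg_rpow_norm {β c : ℝ} (hβ₀ : 0 < β) (hβ₁ : β ≤ 1) (hc : 0 < c) :
    IsFourierNonneg fun v : V => ((Real.exp (-(c * ‖v‖) ^ (2 * β)) : ℝ) : ℂ) := by
  rcases subsingleton_or_nontrivial V with hV | hV
  · simpa [Subsingleton.elim _ (0 : V), hβ₀.ne'] using one (V := V)
  have hmem : ∀ (n : ℕ) (v : V),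
      sibuyaLaplace β (c ^ 2 * (n : ℝ) ^ (-(1 / β)) * ‖v‖ ^ 2) ∈ Icc 0 1 := fun n v =>
    sibuyaLaplace_mem_Icc hβ₀.le (by positivity)
  refine of_tendsto (C := 1) (f := fun n v =>
    ((sibuyaLaplace β (c ^ 2 * (n : ℝ) ^ (-(1 / β)) * ‖v‖ ^ 2) ^ n : ℝ) : ℂ))
    (fun n => ?_) (fun n => ae_of_all _ fun v => ?_) ?_
  · rcases n.eq_zero_or_pos with rfl | hn
    · simpa only [pow_zero, Complex.ofReal_one] using one
    · exact sibuyaLaplace_pow hβ₀.le hβ₁ (by positivity) n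
  · rw [Complex.norm_of_nonneg (pow_nonneg (hmem n v).1 n)]
    exact pow_le_one₀ (hmem n v).1 (hmem n v).2
  · filter_upwards [Measure.ae_ne volume (0 : V)] with v hv
    have hlim := tendsto_sibuyaLaplace_pow hβ₀ (x := (c * ‖v‖) ^ 2) (by positivity)
    rw [← Real.rpow_natCast_mul (by positivity), Nat.cast_ofNat] at hlim
    simpa only [mul_pow, mul_right_comm (c ^ 2), Function.comp_def] using
      (Complex.continuous_ofReal.tendsto _).comp hlim

theorem fourier_nonneg (hφ : IsFourierNonneg φ) (hint : Integrable φ) (w : V) : 0 ≤ 𝓕 φ w := by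
  refine ge_of_tendsto (tendsto_fourier_of_dominated (l := 𝓝[>] (0 : ℝ))
    (φ := fun b v => gaussianWeight b v * φ v) ?_ ?_ hint.norm (ae_of_all _ fun v => ?_) w)
    (eventually_mem_nhdsWithin.mono fun b hb => hφ.fourier_gaussianWeight_mul_nonneg b hb w)
  · filter_upwards [self_mem_nhdsWithin] with b hb
    exact (hφ.integrable_gaussianWeight_mul hb).aestronglyMeasurable
  · filter_upwards [self_mem_nhdsWithin] with b hb
    refine ae_of_all _ fun v => ?_
    rw [norm_mul]
    exact mul_le_of_le_one_left (norm_nonneg _) (norm_gaussianWeight_le_one (le_of_lt hb) v)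
  · simpa only [one_mul] using (tendsto_gaussianWeight_zero v).mul_const (φ v)

end IsFourierNonneg

theorem norm_integral_fourier_mul_gaussianWeight_le {φ : V → ℂ} (hint : Integrable φ) {C : ℝ}
    (hC : ∀ᵐ v, ‖φ v‖ ≤ C) {b : ℝ} (hb : 0 < b) :
    ‖∫ w, 𝓕 φ w * gaussianWeight b w‖ ≤ C := by
  have hflip : ∫ w, 𝓕 φ w * gaussianWeight b w = ∫ v, φ v * 𝓕 (gaussianWeight b : V → ℂ) v := by
    have h := VectorFourier.integral_fourierIntegral_smul_eq_flip (L := innerₗ V)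
      Real.continuous_fourierChar continuous_inner hint (integrable_gaussianWeight (V := V) hb)
    rwa [flip_innerₗ] at h
  rw [hflip]
  refine (norm_integral_le_of_norm_le
    ((integrable_fourier_gaussianWeight hb).norm.const_mul C) ?_).trans_eq ?_
  · filter_upwards [hC] with v hv
    rw [norm_mul]
    gcongr
  · rw [integral_const_mul, integral_norm_fourier_gaussianWeight hb, mul_one]

theorem continuous_fourier {φ : V → ℂ} (hint : Integrable φ) : Continuous (𝓕 φ) :=
  VectorFourier.fourierIntegral_continuous Real.continuous_fourierChar continuous_inner hint

/-- Testing `𝓕 φ` against wider and wider Gaussians, that is `φ` against approximate identities. -/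
theorem eLpNorm_one_fourier_le_of_nonneg {φ : V → ℂ} (hint : Integrable φ) {C : ℝ}
    (hC : ∀ᵐ v, ‖φ v‖ ≤ C) (hnonneg : ∀ w, 0 ≤ 𝓕 φ w) :
    eLpNorm (𝓕 φ) 1 volume ≤ ENNReal.ofReal C := by
  have hcont := continuous_fourier hint
  have hmem : MemLp (𝓕 φ) ∞ := memLp_top_of_bound hcont.aestronglyMeasurable (∫ v, ‖φ v‖)
    (ae_of_all _ (VectorFourier.norm_fourierIntegral_le_integral_norm _ _ _ _))
  have hweight : ∀ b : ℝ, 0 < b → eLpNorm (fun w => 𝓕 φ w * gaussianWeight b w) 1 volume ≤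
      ENNReal.ofReal C := fun b hb => by
    have hprod : Integrable fun w => 𝓕 φ w * gaussianWeight b w :=
      (integrable_gaussianWeight hb).mul_of_top_right hmem
    have hof : ∀ w, 𝓕 φ w * gaussianWeight b w = (‖𝓕 φ w * gaussianWeight b w‖ : ℝ) := fun w =>
      Complex.eq_coe_norm_of_nonneg (mul_nonneg (hnonneg w) (gaussianWeight_nonneg b w))
    have hle := norm_integral_fourier_mul_gaussianWeight_le hint hC hb
    rw [integral_congr_ae (ae_of_all _ hof), integral_complex_ofReal,
      Complex.norm_of_nonneg (integral_nonneg fun w => norm_nonneg _)] at hle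
    rw [eLpNorm_one_eq_lintegral_enorm, ← ofReal_integral_norm_eq_lintegral_enorm hprod]
    exact ENNReal.ofReal_le_ofReal hle
  obtain ⟨b, -, hb_pos, hb_lim⟩ := exists_seq_strictAnti_tendsto (0 : ℝ)
  have hb_lim' : Tendsto b atTop (𝓝[>] 0) :=
    tendsto_nhdsWithin_iff.2 ⟨hb_lim, .of_forall hb_pos⟩
  refine (Lp.eLpNorm_lim_le_liminf_eLpNorm (f := fun n w => 𝓕 φ w * gaussianWeight (b n) w)
    (fun n => (hcont.mul (continuous_gaussianWeight _)).aestronglyMeasurable) _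
    (ae_of_all _ fun w => ?_)).trans
    (liminf_le_of_frequently_le' (.of_forall fun n => hweight (b n) (hb_pos n)))
  simpa only [mul_one, Function.comp_def] using
    ((tendsto_gaussianWeight_zero w).comp hb_lim').const_mul (𝓕 φ w)

theorem integrable_fourier_of_nonneg {φ : V → ℂ} (hint : Integrable φ) {C : ℝ}
    (hC : ∀ᵐ v, ‖φ v‖ ≤ C) (hnonneg : ∀ w, 0 ≤ 𝓕 φ w) : Integrable (𝓕 φ) :=
  memLp_one_iff_integrable.1 ⟨(continuous_fourier hint).aestronglyMeasurable,
    (eLpNorm_one_fourier_le_of_nonneg hint hC hnonneg).trans_lt ENNReal.ofReal_lt_top⟩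

theorem integral_norm_fourier_le_of_nonneg {φ : V → ℂ} (hint : Integrable φ) {C : ℝ}
    (hC : ∀ᵐ v, ‖φ v‖ ≤ C) (hnonneg : ∀ w, 0 ≤ 𝓕 φ w) : ∫ w, ‖𝓕 φ w‖ ≤ C := by
  have hC₀ : 0 ≤ C := (norm_nonneg _).trans hC.exists.choose_spec
  rw [← ENNReal.ofReal_le_ofReal_iff hC₀, ofReal_integral_norm_eq_lintegral_enorm
    (integrable_fourier_of_nonneg hint hC hnonneg), ← eLpNorm_one_eq_lintegral_enorm]
  exact eLpNorm_one_fourier_le_of_nonneg hint hC hnonneg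

end FourierNonneg

theorem integrable_exp_neg_rpow_norm {V : Type*} [NormedAddCommGroup V] [NormedSpace ℝ V]
    [FiniteDimensional ℝ V] [MeasurableSpace V] [BorelSpace V] (μ : Measure V) [μ.IsAddHaarMeasure]
    {p c : ℝ} (hp : 0 < p) (hc : 0 < c) :
    Integrable (fun v : V => Real.exp (-(c * ‖v‖) ^ p)) μ := by
  rcases subsingleton_or_nontrivial V with hV | hV
  · have : IsFiniteMeasure μ := ⟨(Set.toFinite univ).isCompact.measure_lt_top⟩
    exact Integrable.of_finite
  have hdim : -1 < ((Module.finrank ℝ V - 1 : ℕ) : ℝ) :=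
    neg_one_lt_zero.trans_le (Nat.cast_nonneg _)
  refine (integrable_fun_norm_addHaar μ (f := fun r => Real.exp (-(c * r) ^ p))).2 ?_
  refine (integrableOn_rpow_mul_exp_neg_mul_rpow (b := c ^ p) hdim hp (by positivity)).congr_fun
    (fun r hr => ?_) measurableSet_Ioi
  simp only [smul_eq_mul, Real.rpow_natCast, Real.mul_rpow hc.le (le_of_lt hr), neg_mul]

section GreenFunction

variable (d : ℕ) {σ β t : ℝ}

/-- The symbol `exp (-|2πξ|^{2β})` of the fractional heat semigroup at time `1`, of which
`stableDensity` is the inverse Fourier transform; the factor `2π` is that of `stableDensity`. -/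
noncomputable def stableSymbol (β : ℝ) (ξ : EuclideanSpace ℝ (Fin d)) : ℂ :=
  (Real.exp (-(2 * Real.pi * ‖ξ‖) ^ (2 * β)) : ℝ)

theorem norm_stableSymbol_le_one (β : ℝ) (ξ : EuclideanSpace ℝ (Fin d)) :
    ‖stableSymbol d β ξ‖ ≤ 1 := by
  rw [stableSymbol, Complex.norm_of_nonneg (Real.exp_nonneg _)]
  exact Real.exp_le_one_iff.2 (neg_nonpos.2 (by positivity))

theorem integrable_stableSymbol (hβ : 0 < β) : Integrable (stableSymbol d β) :=
  (integrable_exp_neg_rpow_norm volume (by positivity) (by positivity)).ofReal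

theorem fourier_stableSymbol_nonneg (hβ₀ : 0 < β) (hβ₁ : β ≤ 1)
    (x : EuclideanSpace ℝ (Fin d)) : 0 ≤ 𝓕 (stableSymbol d β) x :=
  (IsFourierNonneg.exp_neg_rpow_norm hβ₀ hβ₁ Real.two_pi_pos).fourier_nonneg
    (integrable_stableSymbol d hβ₀) x

theorem stableDensity_eq_re_fourier (β : ℝ) (x : EuclideanSpace ℝ (Fin d)) :
    stableDensity d β x = (𝓕 (stableSymbol d β) (-x)).re :=
  congrArg Complex.re (Real.fourierInv_eq_fourier_neg (stableSymbol d β) x)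

theorem integrable_stableDensity (hβ₀ : 0 < β) (hβ₁ : β ≤ 1) :
    Integrable (stableDensity d β) := by
  rw [funext (stableDensity_eq_re_fourier d β)]
  exact (integrable_fourier_of_nonneg (integrable_stableSymbol d hβ₀)
    (ae_of_all _ (norm_stableSymbol_le_one d β))
    (fourier_stableSymbol_nonneg d hβ₀ hβ₁)).comp_neg.re

theorem integral_norm_stableDensity_le_one (hβ₀ : 0 < β) (hβ₁ : β ≤ 1) :
    ∫ x, ‖stableDensity d β x‖ ≤ 1 := by
  have hint := integrable_stableSymbol d hβ₀
  have hle := ae_of_all volume (norm_stableSymbol_le_one d β)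
  have hnonneg := fourier_stableSymbol_nonneg d hβ₀ hβ₁
  calc ∫ x, ‖stableDensity d β x‖
      ≤ ∫ x, ‖𝓕 (stableSymbol d β) (-x)‖ :=
        integral_mono (integrable_stableDensity d hβ₀ hβ₁).norm
          (integrable_fourier_of_nonneg hint hle hnonneg).comp_neg.norm fun x => by
            rw [stableDensity_eq_re_fourier]
            exact Complex.abs_re_le_norm _
    _ = ∫ x, ‖𝓕 (stableSymbol d β) x‖ :=
        integral_neg_eq_self (fun x => ‖𝓕 (stableSymbol d β) x‖) volume
    _ ≤ 1 := integral_norm_fourier_le_of_nonneg hint hle hnonneg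

theorem integrable_greenFunction (hβ₀ : 0 < β) (hβ₁ : β ≤ 1) (ht : 0 < σ * t) :
    Integrable (greenFunction d σ β t) :=
  ((integrable_comp_smul_iff volume (stableDensity d β) (Real.rpow_pos_of_pos ht _).ne').2
    (integrable_stableDensity d hβ₀ hβ₁)).const_mul _

theorem integral_norm_greenFunction (ht : 0 < σ * t) :
    ∫ x, ‖greenFunction d σ β t x‖ = ∫ x, ‖stableDensity d β x‖ := by
  have hexponent : -((d : ℝ) / (2 * β)) + -(-(1 / (2 * β)) * d) = 0 := by ring
  simp only [greenFunction, norm_mul]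
  rw [integral_const_mul, Measure.integral_comp_smul volume (fun x => ‖stableDensity d β x‖),
    Real.norm_of_nonneg (Real.rpow_nonneg ht.le _), abs_of_nonneg (by positivity), smul_eq_mul,
    ← mul_assoc, finrank_euclideanSpace_fin, ← Real.rpow_natCast, ← Real.rpow_mul ht.le,
    ← Real.rpow_neg ht.le, ← Real.rpow_add ht, hexponent, Real.rpow_zero, one_mul]

end GreenFunction

section Semigroup

variable {d : ℕ} {Z : Type*} [NormedAddCommGroup Z] [NormedSpace ℝ Z] {σ β t : ℝ}

theorem fracSemigroup_apply_add (σ β t : ℝ) (f : EuclideanSpace ℝ (Fin d) → Z)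
    (x v : EuclideanSpace ℝ (Fin d)) :
    fracSemigroup σ β t f (x + v) = fracSemigroup σ β t (fun y => f (y + v)) x := by
  simp only [fracSemigroup, add_sub_right_comm]

theorem norm_fracSemigroup_le (hβ₀ : 0 < β) (hβ₁ : β ≤ 1) (ht : 0 ≤ σ * t)
    {f : EuclideanSpace ℝ (Fin d) → Z} {C : ℝ} (hf : ∀ y, ‖f y‖ ≤ C)
    (x : EuclideanSpace ℝ (Fin d)) : ‖fracSemigroup σ β t f x‖ ≤ C := by
  have hC : 0 ≤ C := (norm_nonneg _).trans (hf x)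
  rcases ht.eq_or_lt with hzero | hpos
  · simpa only [fracSemigroup, ← hzero, if_true] using hf x
  simp only [fracSemigroup, hpos.ne', if_false]
  calc ‖∫ y, greenFunction d σ β t y • f (x - y)‖
      ≤ ∫ y, ‖greenFunction d σ β t y‖ * C :=
        norm_integral_le_of_norm_le ((integrable_greenFunction d hβ₀ hβ₁ hpos).norm.mul_const C)
          (ae_of_all _ fun y => by
            rw [norm_smul]
            exact mul_le_mul_of_nonneg_left (hf _) (norm_nonneg _))
    _ = (∫ y, ‖stableDensity d β y‖) * C := by
        rw [integral_mul_const, integral_norm_greenFunction d hpos]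
    _ ≤ C := mul_le_of_le_one_left hC (integral_norm_stableDensity_le_one d hβ₀ hβ₁)

theorem fracSemigroup_sub (hβ₀ : 0 < β) (hβ₁ : β ≤ 1) (ht : 0 ≤ σ * t)
    {f g : EuclideanSpace ℝ (Fin d) → Z} (hf : MemLp f ∞) (hg : MemLp g ∞)
    (x : EuclideanSpace ℝ (Fin d)) :
    fracSemigroup σ β t (fun y => f y - g y) x =
      fracSemigroup σ β t f x - fracSemigroup σ β t g x := by
  rcases ht.eq_or_lt with hzero | hpos
  · simp only [fracSemigroup, ← hzero, if_true]
  have hint : ∀ {h : EuclideanSpace ℝ (Fin d) → Z}, MemLp h ∞ →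
      Integrable fun y => greenFunction d σ β t y • h (x - y) := fun hh =>
    (integrable_greenFunction d hβ₀ hβ₁ hpos).smul_of_top_left
      (hh.comp_measurePreserving (Measure.measurePreserving_sub_left volume x))
  simp only [fracSemigroup, hpos.ne', if_false, smul_sub]
  exact integral_sub (hint hf) (hint hg)

end Semigroup

section LocallyLipschitz

variable {Z : Type*} [NormedAddCommGroup Z] {F : ℝ → Z → Z} {T : ℝ}

theorem LocallyLipschitzInSnd.exists_lipschitz (hF : LocallyLipschitzInSnd F) (R T : ℝ) :
    ∃ L, 0 ≤ L ∧ ∀ t ∈ Icc 0 T, ∀ z z' : Z, ‖z‖ ≤ R → ‖z'‖ ≤ R →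
      ‖F t z - F t z'‖ ≤ L * ‖z - z'‖ := by
  obtain ⟨L, hL, h⟩ := hF (max R 1) (by positivity) (max T 1) (by positivity)
  exact ⟨L, hL.le, fun t ht z z' hz hz' => h t ⟨ht.1, ht.2.trans (le_max_left _ _)⟩ z z'
    (hz.trans (le_max_left _ _)) (hz'.trans (le_max_left _ _))⟩

theorem LocallyLipschitzInSnd.continuous (hF : LocallyLipschitzInSnd F) {t : ℝ} (ht : 0 ≤ t) :
    Continuous (F t) := by
  refine LocallyLipschitz.continuous fun z₀ => ?_
  obtain ⟨L, hL, h⟩ := hF.exists_lipschitz (‖z₀‖ + 1) t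
  refine ⟨⟨L, hL⟩, Metric.ball z₀ 1, Metric.ball_mem_nhds _ one_pos,
    LipschitzOnWith.of_dist_le_mul fun z hz z' hz' => ?_⟩
  rw [dist_eq_norm, dist_eq_norm]
  exact h t (right_mem_Icc.2 ht) z z' (norm_lt_of_mem_ball hz).le (norm_lt_of_mem_ball hz').le

theorem LocallyLipschitzInSnd.memLp_top_comp (hF : LocallyLipschitzInSnd F) {X : Type*}
    [TopologicalSpace X] [SecondCountableTopology X] [MeasurableSpace X] [OpensMeasurableSpace X]
    {μ : Measure X} {t : ℝ} (ht : 0 ≤ t) (f : X →ᵇ Z) : MemLp (fun x => F t (f x)) ∞ μ := by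
  obtain ⟨L, hL, h⟩ := hF.exists_lipschitz ‖f‖ t
  refine memLp_top_of_bound ((hF.continuous ht).comp f.continuous).aestronglyMeasurable
    (‖F t 0‖ + L * ‖f‖) (ae_of_all _ fun x => ?_)
  have hx := h t (right_mem_Icc.2 ht) (f x) 0 (f.norm_coe_le_norm x) (by simp)
  rw [sub_zero] at hx
  calc ‖F t (f x)‖ ≤ ‖F t 0‖ + ‖F t (f x) - F t 0‖ := norm_le_norm_add_norm_sub' _ _
    _ ≤ ‖F t 0‖ + L * ‖f‖ := by
      gcongr
      exact hx.trans (mul_le_mul_of_nonneg_left (f.norm_coe_le_norm x) hL)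

theorem LocallyLipschitzInSnd.exists_norm_comp_sub_le (hF : LocallyLipschitzInSnd F) {X : Type*}
    [TopologicalSpace X] {u w : ℝ → X →ᵇ Z} (hu : ContinuousOn u (Icc 0 T))
    (hw : ContinuousOn w (Icc 0 T)) :
    ∃ L, 0 ≤ L ∧ ∀ s ∈ Icc 0 T, ∀ x, ‖F s (u s x) - F s (w s x)‖ ≤ L * ‖u s - w s‖ := by
  obtain ⟨Ru, hRu⟩ := isCompact_Icc.exists_bound_of_continuousOn hu
  obtain ⟨Rw, hRw⟩ := isCompact_Icc.exists_bound_of_continuousOn hw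
  obtain ⟨L, hL, h⟩ := hF.exists_lipschitz (max Ru Rw) T
  refine ⟨L, hL, fun s hs x => (h s hs _ _ ?_ ?_).trans
    (mul_le_mul_of_nonneg_left ((u s - w s).norm_coe_le_norm x) hL)⟩
  · exact (((u s).norm_coe_le_norm x).trans (hRu s hs)).trans (le_max_left _ _)
  · exact (((w s).norm_coe_le_norm x).trans (hRw s hs)).trans (le_max_right _ _)

end LocallyLipschitz

theorem eq_zero_of_le_mul_integral {m : ℝ → ℝ} {K T : ℝ} (hm : ContinuousOn m (Icc 0 T))
    (hm₀ : ∀ t ∈ Icc 0 T, 0 ≤ m t) (h : ∀ t ∈ Icc 0 T, m t ≤ K * ∫ s in (0 : ℝ)..t, m s)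
    {t : ℝ} (ht : t ∈ Icc 0 T) : m t = 0 := by
  have hT : 0 ≤ T := ht.1.trans ht.2
  set n : ℝ → ℝ := IccExtend hT ((Icc 0 T).domRestrict m)
  have hn : Continuous n := (continuousOn_iff_continuous_domRestrict.1 hm).Icc_extend'
  have hnm : EqOn n m (Icc 0 T) := fun s hs => IccExtend_of_mem hT _ hs
  have hint : ∀ s ∈ Icc 0 T, ∫ r in (0 : ℝ)..s, n r = ∫ r in (0 : ℝ)..s, m r := fun s hs =>
    intervalIntegral.integral_congr fun r hr => by
      rw [uIcc_of_le hs.1] at hr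
      exact hnm ⟨hr.1, hr.2.trans hs.2⟩
  have hderiv : ∀ s, HasDerivAt (fun s => ∫ r in (0 : ℝ)..s, n r) (n s) s := fun s =>
    intervalIntegral.integral_hasDerivAt_right (hn.intervalIntegrable _ _)
      (hn.stronglyMeasurableAtFilter _ _) hn.continuousAt
  have hzero : ∀ s ∈ Icc 0 T, ∫ r in (0 : ℝ)..s, n r = 0 :=
    eq_zero_of_abs_deriv_le_mul_abs_self_of_eq_zero_right (K := |K|)
      (fun s _ => (hderiv s).continuousAt.continuousWithinAt)
      (fun s _ => (hderiv s).hasDerivWithinAt) intervalIntegral.integral_same fun s hs => by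
        have hs' : s ∈ Icc 0 T := Ico_subset_Icc_self hs
        rw [hnm hs', Real.norm_of_nonneg (hm₀ s hs'), hint s hs', Real.norm_eq_abs, ← abs_mul]
        exact (h s hs').trans (le_abs_self _)
  refine le_antisymm ((h t ht).trans_eq ?_) (hm₀ t ht)
  rw [← hint t ht, hzero t ht, mul_zero]

section MildSolution

variable {d : ℕ} {Z : Type*} [NormedAddCommGroup Z] [NormedSpace ℝ Z]

/-- The translate `x ↦ f (x + v)` of an element `f` of `C_u(ℝᵈ, Z)`. -/
def Cu.translate (v : EuclideanSpace ℝ (Fin d)) (f : Cu d Z) : Cu d Z :=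
  ⟨f.1.compContinuous ⟨fun x => x + v, continuous_add_const v⟩,
    f.2.comp (uniformContinuous_id.add uniformContinuous_const)⟩

theorem Cu.translate_apply (v : EuclideanSpace ℝ (Fin d)) (f : Cu d Z)
    (x : EuclideanSpace ℝ (Fin d)) : (Cu.translate v f).1 x = f.1 (x + v) :=
  rfl

theorem Cu.continuous_translate (v : EuclideanSpace ℝ (Fin d)) :
    Continuous (Cu.translate v : Cu d Z → Cu d Z) :=
  ((BoundedContinuousFunction.continuous_compContinuous _).comp
    continuous_subtype_val).subtype_mk _

theorem mem_CuPeriodic_iff_translate_eq {Γ : Set (EuclideanSpace ℝ (Fin d))} {f : Cu d Z} :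
    f ∈ CuPeriodic Z Γ ↔ ∀ v ∈ Γ, Cu.translate v f = f := by
  simp only [CuPeriodic, mem_ofPred_eq, Subtype.ext_iff, DFunLike.ext_iff, Cu.translate_apply]

namespace IsMildSolutionOn

variable {σ β T : ℝ} {F : ℝ → Z → Z} {u₀ : Cu d Z} {u w : ℝ → Cu d Z} {I J : Set ℝ}

theorem mono (hu : IsMildSolutionOn σ β F u₀ I u) (h : J ⊆ I) : IsMildSolutionOn σ β F u₀ J u :=
  ⟨hu.continuousOn.mono h, fun t ht => hu.integrable t (h ht), fun t ht => hu.equation t (h ht)⟩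

theorem translate (hu : IsMildSolutionOn σ β F u₀ I u) (v : EuclideanSpace ℝ (Fin d)) :
    IsMildSolutionOn σ β F (Cu.translate v u₀) I fun t => Cu.translate v (u t) where
  continuousOn := (Cu.continuous_translate v).comp_continuousOn hu.continuousOn
  integrable t ht x := by
    simpa only [fracSemigroup_apply_add, Cu.translate_apply] using hu.integrable t ht (x + v)
  equation t ht x := by
    simpa only [fracSemigroup_apply_add, Cu.translate_apply] using hu.equation t ht (x + v)

theorem exists_norm_sub_le_mul_integral (hσ : 0 ≤ σ) (hβ₀ : 0 < β) (hβ₁ : β ≤ 1)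
    (hF : LocallyLipschitzInSnd F) (hu : IsMildSolutionOn σ β F u₀ (Icc 0 T) u)
    (hw : IsMildSolutionOn σ β F u₀ (Icc 0 T) w) :
    ∃ K, ∀ t ∈ Icc 0 T, ‖u t - w t‖ ≤ K * ∫ s in (0 : ℝ)..t, ‖u s - w s‖ := by
  obtain ⟨L, hL, hFL⟩ := hF.exists_norm_comp_sub_le
    (continuous_subtype_val.comp_continuousOn hu.continuousOn)
    (continuous_subtype_val.comp_continuousOn hw.continuousOn)
  refine ⟨L, fun t ht => ?_⟩
  have hm : IntervalIntegrable (fun s => ‖u s - w s‖) volume 0 t :=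
    ((hu.continuousOn.sub hw.continuousOn).norm.mono
      (by rw [uIcc_of_le ht.1]; exact Icc_subset_Icc_right ht.2)).intervalIntegrable
  have hm₀ : 0 ≤ ∫ s in (0 : ℝ)..t, ‖u s - w s‖ :=
    intervalIntegral.integral_nonneg ht.1 fun s _ => norm_nonneg _
  refine (BoundedContinuousFunction.norm_le (mul_nonneg hL hm₀)).2 fun x => ?_
  change ‖(u t).1 x - (w t).1 x‖ ≤ _
  rw [hu.equation t ht x, hw.equation t ht x, add_sub_add_left_eq_sub,
    ← intervalIntegral.integral_sub (hu.integrable t ht x) (hw.integrable t ht x),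
    ← intervalIntegral.integral_const_mul]
  refine intervalIntegral.norm_integral_le_of_norm_le ht.1 (ae_of_all _ fun s hs => ?_)
    (hm.const_mul L)
  have hst : 0 ≤ σ * (t - s) := mul_nonneg hσ (sub_nonneg.2 hs.2)
  rw [← fracSemigroup_sub hβ₀ hβ₁ hst (hF.memLp_top_comp hs.1.le _)
    (hF.memLp_top_comp hs.1.le _)]
  exact norm_fracSemigroup_le hβ₀ hβ₁ hst (hFL s ⟨hs.1.le, hs.2.trans ht.2⟩) x

theorem eqOn (hσ : 0 ≤ σ) (hβ₀ : 0 < β) (hβ₁ : β ≤ 1) (hF : LocallyLipschitzInSnd F)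
    (hu : IsMildSolutionOn σ β F u₀ (Icc 0 T) u) (hw : IsMildSolutionOn σ β F u₀ (Icc 0 T) w) :
    EqOn u w (Icc 0 T) := by
  obtain ⟨K, hK⟩ := hu.exists_norm_sub_le_mul_integral hσ hβ₀ hβ₁ hF hw
  exact fun t ht => sub_eq_zero.1 (norm_eq_zero.1 (eq_zero_of_le_mul_integral
    (hu.continuousOn.sub hw.continuousOn).norm (fun s _ => norm_nonneg _) hK ht))

end IsMildSolutionOn

end MildSolution

theorem mainTheorem3_general {d : ℕ} {Z : Type*} [NormedAddCommGroup Z] [NormedSpace ℝ Z]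
    [CompleteSpace Z] {σ β T : ℝ} (hσ : 0 ≤ σ) (hβ₀ : 0 < β) (hβ₁ : β ≤ 1) {F : ℝ → Z → Z}
    (hFlip : LocallyLipschitzInSnd F) {Γ : Set (EuclideanSpace ℝ (Fin d))} {u₀ : Cu d Z}
    (hu₀ : u₀ ∈ CuPeriodic Z Γ) {u : ℝ → Cu d Z} (hu : IsMildSolutionOn σ β F u₀ (Icc 0 T) u) :
    ∀ t ∈ Icc 0 T, u t ∈ CuPeriodic Z Γ := by
  intro t ht
  refine mem_CuPeriodic_iff_translate_eq.2 fun v hv => ?_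
  have htranslate := hu.translate v
  rw [mem_CuPeriodic_iff_translate_eq.1 hu₀ v hv] at htranslate
  exact htranslate.eqOn hσ hβ₀ hβ₁ hFlip hu ht

theorem mainTheorem3 {d q : ℕ} {Z : Type*} [NormedAddCommGroup Z] [NormedSpace ℝ Z]
    [CompleteSpace Z] (σ β : ℝ) (hσ : 0 ≤ σ) (hβ₀ : 0 < β) (hβ₁ : β ≤ 1)
    (F : ℝ → Z → Z)
    (hFcont : ContinuousOn (fun p : ℝ × Z => F p.1 p.2) (Set.Ici 0 ×ˢ Set.univ))
    (hFlip : LocallyLipschitzInSnd F)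
    (γ : Fin q → EuclideanSpace ℝ (Fin d)) (hγ : LinearIndependent ℝ γ)
    (u₀ : Cu d Z) (hu₀ : u₀ ∈ CuPeriodic Z (latticeOf γ))
    (u : ℝ → Cu d Z)
    (hu : IsMildSolutionOn σ β F u₀ {t : ℝ | 0 ≤ t ∧ (t : EReal) < maximalTime σ β F u₀} u) :
    ∀ t : ℝ, 0 ≤ t → (t : EReal) < maximalTime σ β F u₀ →
      u t ∈ CuPeriodic Z (latticeOf γ) := fun t ht htT =>
  mainTheorem3_general hσ hβ₀ hβ₁ hFlip hu₀ (hu.mono fun _ hs =>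
    ⟨hs.1, (EReal.coe_le_coe_iff.2 hs.2).trans_lt htT⟩) t (right_mem_Icc.2 ht)
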